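/- A closure operator on a set $X$ is a map $c:2^X\to 2^X$ with $c(\varnothing)=\varnothing$, $A\subset c(A)$ and $c(A\cup B)=c(A)\cup c(B)$; a map $f:(X,c)\to(Y,d)$ of closure spaces is continuous if $f(c(A))\subset d(f(A))$ for all $A\subset X$, and topological spaces are regarded as closure spaces through their topological closure. For a closure space $(X,c)$ and $k\in\mathbb{N}=\{0,1,2,\dots\}$ let $H_k(X,c)$ be its singular homology: the $k$-th homology group of the chain complex whose group in degree $p$ is the free abelian group on the continuous maps $\sigma:|\Delta^p|\to (X,c)$, where $|\Delta^p|\subset\mathbb{R}^{p+1}$ is the standard simplex with its usual topology, with differential $\partial\sigma=\sum_{i=0}^{p}(-1)^i\,\sigma|_{[e_0,\dots,\hat e_i,\dots,e_p]}$. For integers $n\ge 1$ and $m\ge 0$ let $\mathbb{Z}_n=\{0,1,\dots,n-1\}$ with the metric $d(i,j)=\min\{|k| : k\in\mathbb{Z},\ k\equiv i-j \bmod n\}$, and let $c_m$ be the closure operator $c_m(A)=\{j\in\mathbb{Z}_n : d(i,j)\le m \text{ for some } i\in A\}$. **Theorem.** Let $m\ge 2$ and let $n=3m+l$, where $l$ is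 an integer with $\max(0,m-3)<l<m$. Then there are group isomorphisms \[H_k(\mathbb{Z}_n,c_m)\cong H_k(\mathbb{Z}_{n+4},c_{m+1})\qquad\text{for all } k\in\mathbb{N}.\] -/

import Mathlib

open CategoryTheory

/-- A Čech closure operator on a set `X`: it fixes the empty set, is extensive, and is additive on
binary unions; idempotency is not required. A closure space is a set with such an operator. -/
structure CechClosure (X : Type) where
  /-- the closure of a subset -/
  cl : Set X → Set X
  cl_empty : cl ∅ = ∅
  subset_cl : ∀ A : Set X, A ⊆ cl A
  cl_union : ∀ A B : Set X, cl (A ∪ B) = cl A ∪ cl B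

namespace CechClosure

/-- The (Kuratowski) closure operator of a topological space. -/
def ofTopology (X : Type) [TopologicalSpace X] : CechClosure X where
  cl := closure
  cl_empty := closure_empty
  subset_cl _ := subset_closure
  cl_union _ _ := closure_union

/-- A map `f : (X, c) → (Y, d)` of closure spaces is continuous if `f (c A) ⊆ d (f A)` for every
`A ⊆ X`. -/
def IsContinuous {X Y : Type} (c : CechClosure X) (d : CechClosure Y) (f : X → Y) : Prop :=
  ∀ A : Set X, f '' c.cl A ⊆ d.cl (f '' A)

theorem IsContinuous.comp {X Y Z : Type} {c : CechClosure X} {d : CechClosure Y}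
    {e : CechClosure Z} {g : Y → Z} {f : X → Y} (hg : IsContinuous d e g)
    (hf : IsContinuous c d f) : IsContinuous c e (g ∘ f) := by
  intro A
  rw [Set.image_comp, Set.image_comp]
  exact (Set.image_mono (hf A)).trans (hg _)

theorem isContinuous_ofTopology {X Y : Type} [TopologicalSpace X] [TopologicalSpace Y]
    {f : X → Y} (hf : Continuous f) : IsContinuous (ofTopology X) (ofTopology Y) f :=
  fun _ => image_closure_subset_closure_image hf

/-- The singular simplices of a closure space: continuous maps from the standard topological
simplex on the vertices `0, …, n`. -/
def SingularSimplex {X : Type} (c : CechClosure X) (n : ℕ) : Type :=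
  {σ : stdSimplex ℝ (Fin (n + 1)) → X //
    IsContinuous (ofTopology (stdSimplex ℝ (Fin (n + 1)))) c σ}

/-- The singular simplicial set of a closure space: faces and degeneracies are given by
precomposition with the affine maps between standard simplices. -/
noncomputable def singularSet {X : Type} (c : CechClosure X) : SSet.{0} where
  obj n := SingularSimplex c n.unop.len
  map f := TypeCat.ofHom fun σ =>
    ⟨σ.1 ∘ stdSimplex.map f.unop,
      σ.2.comp (isContinuous_ofTopology (stdSimplex.continuous_map f.unop))⟩
  map_id n := by
    ext σ
    apply Subtype.ext
    funext x
    change σ.1 (stdSimplex.map id x) = σ.1 x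
    rw [stdSimplex.map_id_apply]
  map_comp f g := by
    ext σ
    apply Subtype.ext
    funext x
    change σ.1 (stdSimplex.map (f.unop ∘ g.unop) x) =
      σ.1 (stdSimplex.map f.unop (stdSimplex.map g.unop x))
    rw [stdSimplex.map_comp_apply]

/-- The `k`-th singular homology group `H_k(X, c)` with integer coefficients: the homology in
degree `k` of the complex whose group of `n`-chains is the free abelian group on the singular
`n`-simplices, with differential the alternating sum of the faces. -/
noncomputable def singularHomology {X : Type} (c : CechClosure X) (k : ℕ) : AddCommGrpCat.{0} :=
  (singularSet c).homology (AddCommGrpCat.of ℤ) k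

end CechClosure

/-- The distance on `ℤ_n = {0, …, n - 1}`: the least absolute value of an integer congruent to
`i - j` modulo `n`. -/
noncomputable def cyclicDist {n : ℕ} (i j : Fin n) : ℕ :=
  sInf {a : ℕ | ∃ k : ℤ, k ≡ (i : ℤ) - (j : ℤ) [ZMOD (n : ℤ)] ∧ a = k.natAbs}

/-- The closure operator `c_m` on `ℤ_n`, adding to a set all points at distance at most `m`
from one of its points. -/
noncomputable def cyclicClosure (n m : ℕ) : CechClosure (Fin n) where
  cl A := ⋃ i ∈ A, {j | cyclicDist i j ≤ m}
  cl_empty := by simp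
  subset_cl A := by
    intro i hi
    have h : cyclicDist i i = 0 :=
      Nat.sInf_eq_zero.2 (Or.inl ⟨0, by simp⟩)
    exact Set.mem_iUnion₂.2 ⟨i, hi, by simp [h]⟩
  cl_union A B := Set.biUnion_union A B _

/-!
Write `c_m` also for the closure operator on `ℤ` that adds all integers at distance at most `m`.
If `3m < n`, reduction modulo `n` behaves like a covering map `(ℤ, c_m) → (ℤ_n, c_m)`: a window of
radius `m` around a residue lifts uniquely to a window around any chosen representative, and two
points of that window whose residues are `m`-close are themselves `m`-close, because `3m < n`. So
singular simplices of `ℤ_n` lift to `ℤ` (`exists_isLiftOn_stdSimplex`: cut the simplex into small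
convex pieces and glue the lifts), and two lifts differ by a multiple of `n`
(`IsLiftOn.exists_eq_add`). Hence, with `T` the translation by `n`, the sequence of singular chain
complexes
`0 → C(ℤ, c_m) --(T - 1)--> C(ℤ, c_m) → C(ℤ_n, c_m) → 0`
is exact (`singular_shortExact`).

The line `(ℤ, c_m)` is contractible for `m ≥ 1`: truncating integers to intervals `[-s, s]`, with
`s` running from `∞` down to `0`, cones off every singular simplex in a way compatible with faces
and degeneracies. This is an extra degeneracy on the singular set (`intExtraDegeneracy`), so every
continuous map between two such lines is a quasi-isomorphism.

Finally, when `m * n' ≤ m' * n`, the map `a ↦ ⌊n' a / n⌋` is continuous `(ℤ, c_m) → (ℤ, c_m')` and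
carries translation by `n` to translation by `n'`. It descends to a map `ℤ_n → ℤ_n'`, and comparing
the two exact sequences shows that this map is a quasi-isomorphism (`quasiIso_cyclicRescale`). As
`n = 3m + l < 4m`, this applies to the rescaling from `(ℤ_{n+4}, c_{m+1})` to `(ℤ_n, c_m)`, the
condition `(m + 1) n ≤ m (n + 4)` being `n ≤ 4m`.
-/

/-! ### Continuity for closure operators given by relations -/

namespace CechClosure

section Relation

variable {X Y Z : Type}

/-- A map from a topological space to a closure space whose closure operator is given by a relation
is continuous if and only if near each point its values are related to the value at that point. -/
theorem isContinuous_ofTopology_iff [TopologicalSpace X] {c : CechClosure Y} {r : Y → Y → Prop}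
    (hc : ∀ A y, y ∈ c.cl A ↔ ∃ a ∈ A, r a y) {f : X → Y} :
    IsContinuous (ofTopology X) c f ↔ ∀ x, ∀ᶠ y in nhds x, r (f y) (f x) := by
  constructor
  · intro hf x
    by_contra hx
    have hcl : x ∈ closure {y | ¬ r (f y) (f x)} :=
      mem_closure_iff_frequently.2 (Filter.not_eventually.1 hx)
    obtain ⟨_, ⟨y, hy, rfl⟩, hr⟩ := (hc _ _).1 (hf _ ⟨x, hcl, rfl⟩)
    exact hy hr
  · rintro hf A _ ⟨x, hx, rfl⟩
    obtain ⟨y, hyA, hr⟩ := ((mem_closure_iff_frequently.1 hx).and_eventually (hf x)).exists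
    exact (hc _ _).2 ⟨f y, ⟨y, hyA, rfl⟩, hr⟩

theorem isContinuous_of_rel {c : CechClosure Y} {d : CechClosure Z} {r : Y → Y → Prop}
    {s : Z → Z → Prop} (hc : ∀ A y, y ∈ c.cl A ↔ ∃ a ∈ A, r a y)
    (hd : ∀ A y, y ∈ d.cl A ↔ ∃ a ∈ A, s a y) {f : Y → Z}
    (hf : ∀ a b, r a b → s (f a) (f b)) : IsContinuous c d f := by
  rintro A _ ⟨y, hy, rfl⟩
  obtain ⟨a, ha, hr⟩ := (hc _ _).1 hy
  exact (hd _ _).2 ⟨f a, ⟨a, ha, rfl⟩, hf _ _ hr⟩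

end Relation

end CechClosure

open CechClosure

/-! ### The line and the cycle as closure spaces -/

/-- The closure operator on `ℤ` adding to a set all integers at distance at most `m` from one of
its points. -/
def intClosure (m : ℕ) : CechClosure ℤ where
  cl A := {y | ∃ a ∈ A, |a - y| ≤ (m : ℤ)}
  cl_empty := by simp
  subset_cl A := fun a ha => ⟨a, ha, by simp⟩
  cl_union A B := by
    ext y
    simp only [Set.mem_union, Set.mem_ofPred_eq, or_and_right, exists_or]

theorem mem_intClosure_cl {m : ℕ} (A : Set ℤ) (y : ℤ) :
    y ∈ (intClosure m).cl A ↔ ∃ a ∈ A, |a - y| ≤ (m : ℤ) := Iff.rfl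

theorem cyclicDist_le_iff {n m : ℕ} {i j : Fin n} :
    cyclicDist i j ≤ m ↔ ∃ d : ℤ, |d| ≤ (m : ℤ) ∧ (n : ℤ) ∣ (i : ℤ) - j - d := by
  constructor
  · intro h
    obtain ⟨k, hk, hd⟩ := Nat.sInf_mem
      (s := {a : ℕ | ∃ k : ℤ, k ≡ (i : ℤ) - (j : ℤ) [ZMOD (n : ℤ)] ∧ a = k.natAbs})
      ⟨_, _, Int.ModEq.refl _, rfl⟩
    refine ⟨k, ?_, hk.dvd⟩
    have h' : k.natAbs ≤ m := hd ▸ h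
    rw [Int.abs_eq_natAbs]
    omega
  · rintro ⟨d, hd, hdvd⟩
    refine le_trans (Nat.sInf_le ⟨d, (Int.modEq_iff_dvd.2 hdvd), rfl⟩) ?_
    rw [Int.abs_eq_natAbs] at hd
    omega

theorem mem_cyclicClosure_cl {n m : ℕ} (A : Set (Fin n)) (y : Fin n) :
    y ∈ (cyclicClosure n m).cl A ↔
      ∃ a ∈ A, ∃ d : ℤ, |d| ≤ (m : ℤ) ∧ (n : ℤ) ∣ (a : ℤ) - y - d := by
  simp only [cyclicClosure, Set.mem_iUnion, Set.mem_ofPred_eq, cyclicDist_le_iff, exists_prop]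

/-! ### Lifting along the projection from `ℤ` to `ℤ_n` -/

theorem Int.eq_of_dvd_sub_of_abs_lt {n a b : ℤ} (h : n ∣ a - b) (hlt : |a - b| < n) : a = b :=
  sub_eq_zero.1 (Int.eq_zero_of_abs_lt_dvd h hlt)

section Lifting

variable {X : Type} [TopologicalSpace X]

/-- `h` is a lift over `S` of the `ℤ_n`-valued map represented by `g`: it is congruent to `g`
modulo `n` and continuous, as a map from the subspace `S` to `ℤ` with the closure operator
`c_m`. -/
def IsLiftOn (n m : ℕ) (g : X → ℤ) (S : Set X) (h : X → ℤ) : Prop :=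
  (∀ x ∈ S, (n : ℤ) ∣ h x - g x) ∧ ∀ x ∈ S, ∀ᶠ y in nhdsWithin x S, |h y - h x| ≤ (m : ℤ)

variable {n m : ℕ} {g h h₁ h₂ : X → ℤ} {S T S₁ S₂ : Set X}

theorem IsLiftOn.mono (hh : IsLiftOn n m g S h) (hT : T ⊆ S) : IsLiftOn n m g T h :=
  ⟨fun x hx => hh.1 x (hT hx), fun x hx => (hh.2 x (hT hx)).filter_mono (nhdsWithin_mono x hT)⟩

theorem IsLiftOn.add_const (hh : IsLiftOn n m g S h) {k : ℤ} (hk : (n : ℤ) ∣ k) :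
    IsLiftOn n m g S (fun x => h x + k) := by
  refine ⟨fun x hx => ?_, fun x hx => ?_⟩
  · have := dvd_add (hh.1 x hx) hk
    rwa [show h x + k - g x = h x - g x + k by ring]
  · simpa using hh.2 x hx

/-- Two lifts over a connected set differ by a constant, since their difference is locally
constant: it takes values in `nℤ` and varies locally by at most `2m < n`. -/
theorem IsLiftOn.exists_eq_add (hmn : 2 * m < n) (hS : _root_.IsPreconnected S)
    (H₁ : IsLiftOn n m g S h₁) (H₂ : IsLiftOn n m g S h₂) :
    ∃ k : ℤ, (n : ℤ) ∣ k ∧ ∀ x ∈ S, h₂ x = h₁ x + k := by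
  have hd : ∀ x ∈ S, (n : ℤ) ∣ h₂ x - h₁ x := fun x hx => by
    simpa using dvd_sub (H₂.1 x hx) (H₁.1 x hx)
  have hcont : ContinuousOn (fun x => h₂ x - h₁ x) S := by
    intro x hx
    refine tendsto_nhds_of_eventually_eq ?_
    filter_upwards [H₁.2 x hx, H₂.2 x hx, self_mem_nhdsWithin] with y h1 h2 hy
    refine Int.eq_of_dvd_sub_of_abs_lt (dvd_sub (hd y hy) (hd x hx)) ?_
    rw [abs_lt]; rw [abs_le] at h1 h2
    omega
  rcases S.eq_empty_or_nonempty with rfl | ⟨x₀, hx₀⟩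
  · exact ⟨0, dvd_zero _, by simp⟩
  · refine ⟨h₂ x₀ - h₁ x₀, hd _ hx₀, fun x hx => ?_⟩
    have : h₂ x - h₁ x = h₂ x₀ - h₁ x₀ := hS.constant hcont hx hx₀
    omega

open Classical in
/-- Lifts over two closed sets with connected intersection can be glued. -/
theorem exists_isLiftOn_union (hmn : 2 * m < n) (hS₁ : IsClosed S₁) (hS₂ : IsClosed S₂)
    (hc : _root_.IsPreconnected (S₁ ∩ S₂)) (H₁ : ∃ h, IsLiftOn n m g S₁ h)
    (H₂ : ∃ h, IsLiftOn n m g S₂ h) : ∃ h, IsLiftOn n m g (S₁ ∪ S₂) h := by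
  obtain ⟨h₁, H₁⟩ := H₁
  obtain ⟨h₂, H₂⟩ := H₂
  obtain ⟨k, hk, he⟩ := (H₁.mono Set.inter_subset_left).exists_eq_add hmn hc
    (H₂.mono Set.inter_subset_right)
  have H₁' := H₁.add_const hk
  set f : X → ℤ := fun x => if x ∈ S₁ then h₁ x + k else h₂ x with hf
  have f₁ : ∀ x ∈ S₁, f x = h₁ x + k := fun x hx => if_pos hx
  have f₂ : ∀ x ∈ S₂, f x = h₂ x := fun x hx => by
    by_cases hx₁ : x ∈ S₁
    · rw [f₁ x hx₁, he x ⟨hx₁, hx⟩]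
    · exact if_neg hx₁
  have key : ∀ (S : Set X) (h : X → ℤ), IsClosed S → IsLiftOn n m g S h → (∀ x ∈ S, f x = h x) →
      ∀ x, ∀ᶠ y in nhdsWithin x S, |f y - f x| ≤ (m : ℤ) := by
    intro S h hS H hfh x
    by_cases hx : x ∈ S
    · filter_upwards [H.2 x hx, self_mem_nhdsWithin] with y hy hyS
      rwa [hfh y hyS, hfh x hx]
    · have : nhdsWithin x S = ⊥ := by
        rwa [← Filter.not_neBot, ← mem_closure_iff_nhdsWithin_neBot, hS.closure_eq]
      rw [this]
      exact Filter.eventually_bot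
  refine ⟨f, ?_, fun x _ => ?_⟩
  · rintro x (hx | hx)
    · rw [f₁ x hx]; exact H₁'.1 x hx
    · rw [f₂ x hx]; exact H₂.1 x hx
  · rw [nhdsWithin_union, Filter.eventually_sup]
    exact ⟨key _ _ hS₁ H₁' f₁ x, key _ _ hS₂ H₂ f₂ x⟩

/-- A lift exists over a set on which `g` stays within `m` of a single value modulo `n`: two
representatives in a window of radius `m` whose classes are `m`-close differ by at most `m`, since
`3m < n`. -/
theorem exists_isLiftOn_of_near (hmn : 3 * m < n) {a : ℤ}
    (hg : ∀ x, ∀ᶠ y in nhds x, ∃ d : ℤ, |d| ≤ (m : ℤ) ∧ (n : ℤ) ∣ g y - g x - d)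
    (ha : ∀ x ∈ S, ∃ d : ℤ, |d| ≤ (m : ℤ) ∧ (n : ℤ) ∣ g x - a - d) :
    ∃ h, IsLiftOn n m g S h := by
  choose! d hd hdvd using ha
  refine ⟨fun x => a + d x, fun x hx => ?_, fun x hx => ?_⟩
  · rw [← dvd_neg, show -(a + d x - g x) = g x - a - d x by ring]
    exact hdvd x hx
  · filter_upwards [nhdsWithin_le_nhds (hg x), self_mem_nhdsWithin] with y ⟨e, he, hedvd⟩ hy
    have h1 := dvd_sub (dvd_sub (hdvd y hy) (hdvd x hx)) hedvd
    have h2 : d x - d y = -e := by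
      refine Int.eq_of_dvd_sub_of_abs_lt (n := n) ?_ ?_
      · rwa [show d x - d y - -e = g y - a - d y - (g x - a - d x) - (g y - g x - e) by ring]
      · have := hd x hx
        have := hd y hy
        rw [abs_le] at *
        rw [abs_lt]
        omega
    rwa [show a + d y - (a + d x) = e by omega]

end Lifting

section Simplex

variable {p : ℕ}

theorem isPreconnected_of_convex_image {S : Set (stdSimplex ℝ (Fin p))}
    (hS : Convex ℝ (Subtype.val '' S)) : _root_.IsPreconnected S :=
  Topology.IsInducing.subtypeVal.isPreconnected_image.1 hS.isPreconnected

/-- The part of the simplex where the `j`-th coordinate lies in `[a, b]`. -/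
def simplexSlab (j : Fin p) (a b : ℝ) : Set (stdSimplex ℝ (Fin p)) := {x | x j ∈ Set.Icc a b}

theorem isClosed_simplexSlab (j : Fin p) (a b : ℝ) : IsClosed (simplexSlab j a b) :=
  isClosed_Icc.preimage ((continuous_apply j).comp continuous_subtype_val)

theorem convex_image_inter_simplexSlab {S : Set (stdSimplex ℝ (Fin p))}
    (hS : Convex ℝ (Subtype.val '' S)) (j : Fin p) (a b : ℝ) :
    Convex ℝ (Subtype.val '' (S ∩ simplexSlab j a b)) := by
  have : Subtype.val '' (S ∩ simplexSlab j a b) =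
      Subtype.val '' S ∩ (LinearMap.proj (R := ℝ) (φ := fun _ : Fin p => ℝ) j) ⁻¹' Set.Icc a b := by
    rw [← Set.image_inter_preimage]
    rfl
  rw [this]
  exact hS.inter ((convex_Icc a b).linear_preimage _)

variable {n m : ℕ} {g : stdSimplex ℝ (Fin p) → ℤ}

/-- If lifts exist over all closed convex pieces whose width in each direction is at most `ε`, then
they exist over the pieces with no constraint on the widths in the directions of `J`: one
direction at a time, a piece is cut into slabs of width `ε`. -/
theorem exists_isLiftOn_of_small (hmn : 2 * m < n) {ε : ℝ} (hε : 0 < ε)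
    (hsmall : ∀ S : Set (stdSimplex ℝ (Fin p)), (∀ i, ∀ x ∈ S, ∀ y ∈ S, x i - y i ≤ ε) →
      ∃ h, IsLiftOn n m g S h) (J : Finset (Fin p)) :
    ∀ S : Set (stdSimplex ℝ (Fin p)), IsClosed S → Convex ℝ (Subtype.val '' S) →
      (∀ i ∉ J, ∀ x ∈ S, ∀ y ∈ S, x i - y i ≤ ε) → ∃ h, IsLiftOn n m g S h := by
  induction J using Finset.induction_on with
  | empty => exact fun S _ _ hS => hsmall S fun i => hS i (Finset.notMem_empty i)
  | insert j J hj ih =>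
    have main : ∀ (N : ℕ) (a : ℝ) (S : Set (stdSimplex ℝ (Fin p))), IsClosed S →
        Convex ℝ (Subtype.val '' S) → (∀ i ∉ insert j J, ∀ x ∈ S, ∀ y ∈ S, x i - y i ≤ ε) →
        (∀ x ∈ S, a ≤ x j ∧ x j ≤ a + (N + 1 : ℝ) * ε) → ∃ h, IsLiftOn n m g S h := by
      intro N
      induction N with
      | zero =>
        intro a S hcl hcv hS hj
        refine ih S hcl hcv fun i hi x hx y hy => ?_
        by_cases hij : i = j
        · subst hij
          have := hj x hx
          have := hj y hy
          norm_num at *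
          linarith
        · exact hS i (by simp [hij, hi]) x hx y hy
      | succ N ihN =>
        intro a S hcl hcv hS hj
        have hU : S = S ∩ simplexSlab j a (a + ε) ∪
            S ∩ simplexSlab j (a + ε) (a + ε + (N + 1 : ℝ) * ε) := by
          rw [← Set.inter_union_distrib_left, eq_comm, Set.inter_eq_left]
          intro x hx
          obtain ⟨h1, h2⟩ := hj x hx
          push_cast at h2
          rcases le_total (x j) (a + ε) with h | h
          · exact Or.inl ⟨h1, h⟩
          · exact Or.inr ⟨h, by linarith⟩
        rw [hU]
        refine exists_isLiftOn_union hmn (hcl.inter (isClosed_simplexSlab _ _ _))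
          (hcl.inter (isClosed_simplexSlab _ _ _)) ?_ ?_ ?_
        · rw [← Set.inter_inter_distrib_left, ← Set.inter_assoc]
          exact isPreconnected_of_convex_image (convex_image_inter_simplexSlab
            (convex_image_inter_simplexSlab hcv _ _ _) _ _ _)
        · refine ih _ (hcl.inter (isClosed_simplexSlab _ _ _))
            (convex_image_inter_simplexSlab hcv _ _ _) fun i hi x hx y hy => ?_
          by_cases hij : i = j
          · subst hij
            have := hx.2.2
            have := hy.2.1
            linarith
          · exact hS i (by simp [hij, hi]) x hx.1 y hy.1
        · exact ihN (a + ε) _ (hcl.inter (isClosed_simplexSlab _ _ _))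
            (convex_image_inter_simplexSlab hcv _ _ _)
            (fun i hi x hx y hy => hS i hi x hx.1 y hy.1) fun x hx => hx.2
    intro S hcl hcv hS
    obtain ⟨N, hN⟩ := exists_nat_gt (1 / ε)
    refine main N 0 S hcl hcv hS fun x _ => ⟨stdSimplex.zero_le x j, ?_⟩
    have h1 := stdSimplex.le_one x j
    rw [div_lt_iff₀ hε] at hN
    linarith

/-- Every continuous map from a simplex to `ℤ_n` lifts to `ℤ`: by the Lebesgue number lemma, pieces
of the simplex that are narrow in every coordinate lie in a set where the map stays within `m` of
a single value. -/
theorem exists_isLiftOn_stdSimplex (hmn : 3 * m < n)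
    (hg : ∀ x, ∀ᶠ y in nhds x, ∃ d : ℤ, |d| ≤ (m : ℤ) ∧ (n : ℤ) ∣ g y - g x - d) :
    ∃ h, IsLiftOn n m g Set.univ h := by
  choose U hU hUo hxU using fun x => eventually_nhds_iff.1 (hg x)
  obtain ⟨δ, hδ, hball⟩ := lebesgue_number_lemma_of_metric (isCompact_univ
    (X := stdSimplex ℝ (Fin p))) hUo fun x _ => Set.mem_iUnion.2 ⟨x, hxU x⟩
  refine exists_isLiftOn_of_small (by omega) (half_pos hδ) (fun S hS => ?_) Finset.univ _
    isClosed_univ (by simpa using convex_stdSimplex ℝ (Fin p)) (by simp)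
  rcases S.eq_empty_or_nonempty with rfl | ⟨x₀, hx₀⟩
  · exact ⟨g, by simp, by simp⟩
  · obtain ⟨w, hw⟩ := hball x₀ (Set.mem_univ _)
    refine exists_isLiftOn_of_near hmn hg (a := g w) fun x hx => hU w x (hw ?_)
    rw [Metric.mem_ball, Subtype.dist_eq, dist_pi_lt_iff hδ]
    intro i
    have h1 : x i - x₀ i ≤ δ / 2 := hS i x hx x₀ hx₀
    have h2 : x₀ i - x i ≤ δ / 2 := hS i x₀ hx₀ x hx
    change |x i - x₀ i| < δ
    rw [abs_lt]
    constructor <;> linarith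

end Simplex

/-! ### Coning off simplices of `ℤ` -/

/-- The retraction of `ℤ` onto `[-s, s]`, where `s = ⌊1 / t⌋ - 1`; the interval is all of `ℤ` for
`t = 0` and is `{0}` for `1 / 2 < t ≤ 1`. -/
noncomputable def clampAt (t : ℝ) (a : ℤ) : ℤ :=
  if t = 0 then a else max (-(⌊1 / t⌋ - 1)) (min a (⌊1 / t⌋ - 1))

@[simp] theorem clampAt_zero (a : ℤ) : clampAt 0 a = a := if_pos rfl

theorem clampAt_of_half_lt {t : ℝ} (h₁ : 1 / 2 < t) (h₂ : t ≤ 1) (a : ℤ) : clampAt t a = 0 := by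
  have ht : 0 < t := by linarith
  have hfl : ⌊1 / t⌋ = 1 := by
    rw [Int.floor_eq_iff, le_div_iff₀ ht, div_lt_iff₀ ht]
    constructor <;> push_cast <;> linarith
  rw [clampAt, if_neg ht.ne', hfl]
  omega

theorem clampAt_eq_self {t : ℝ} {a : ℤ} (h₀ : 0 ≤ t) (h : t * (|a| + 1 : ℤ) ≤ 1) :
    clampAt t a = a := by
  rcases h₀.eq_or_lt with rfl | ht
  · exact clampAt_zero a
  · have hfl : |a| + 1 ≤ ⌊1 / t⌋ := by
      rw [Int.le_floor, le_div_iff₀ ht, mul_comm]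
      exact h
    rw [clampAt, if_neg ht.ne']
    rw [Int.abs_eq_natAbs] at hfl
    omega

/-- Truncation is non-expansive for the maximum of the distances of the bounds and of the
arguments. -/
theorem abs_clampAt_sub_le {m : ℕ} (hm : 1 ≤ m) {t u : ℝ} (ht : t ≠ 0) (hu : u ≠ 0)
    (htu : |1 / t - 1 / u| < 1) {a b : ℤ} (hab : |a - b| ≤ (m : ℤ)) :
    |clampAt t a - clampAt u b| ≤ (m : ℤ) := by
  have h1 : |⌊1 / t⌋ - ⌊1 / u⌋| ≤ 1 := by
    rw [abs_lt] at htu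
    have h2 := Int.floor_le (1 / t)
    have h3 := Int.lt_floor_add_one (1 / t)
    have h4 := Int.floor_le (1 / u)
    have h5 := Int.lt_floor_add_one (1 / u)
    have h6 : ⌊1 / t⌋ < ⌊1 / u⌋ + 2 := by exact_mod_cast (by push_cast; linarith :
      ((⌊1 / t⌋ : ℤ) : ℝ) < ((⌊1 / u⌋ + 2 : ℤ) : ℝ))
    have h7 : ⌊1 / u⌋ < ⌊1 / t⌋ + 2 := by exact_mod_cast (by push_cast; linarith :
      ((⌊1 / u⌋ : ℤ) : ℝ) < ((⌊1 / t⌋ + 2 : ℤ) : ℝ))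
    rw [abs_le]
    omega
  rw [clampAt, clampAt, if_neg ht, if_neg hu]
  rw [abs_le] at *
  omega

section Cone

variable {p q : ℕ}

/-- The projection of a simplex from its vertex `0` to the opposite face, defined away from that
vertex. -/
noncomputable def simplexTail (x : stdSimplex ℝ (Fin (p + 1))) (hx : x 0 < 1) :
    stdSimplex ℝ (Fin p) :=
  ⟨fun i => x i.succ / (1 - x 0),
    fun i => div_nonneg (stdSimplex.zero_le x _) (by linarith), by
      have h := stdSimplex.sum_eq_one x
      rw [Fin.sum_univ_succ] at h
      rw [← Finset.sum_div, div_eq_one_iff_eq (by linarith)]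
      linarith⟩

/-- The cone over a map `f` on a face of the simplex: the segment from the vertex `0` to a point
`y` of the face carries the values of `f y` truncated to intervals that grow from `{0}` at the
vertex to `ℤ` at the face. -/
noncomputable def coneFun (f : stdSimplex ℝ (Fin p) → ℤ) (x : stdSimplex ℝ (Fin (p + 1))) : ℤ :=
  if hx : x 0 < 1 then clampAt (x 0) (f (simplexTail x hx)) else 0

theorem coneFun_of_half_lt (f : stdSimplex ℝ (Fin p) → ℤ) {x : stdSimplex ℝ (Fin (p + 1))}
    (hx : 1 / 2 < x 0) : coneFun f x = 0 := by
  rw [coneFun]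
  split_ifs with h
  · exact clampAt_of_half_lt hx h.le _
  · rfl

theorem stdSimplex_map_apply {ι κ : Type} [Fintype ι] [Fintype κ] [DecidableEq κ] (φ : ι → κ)
    (x : stdSimplex ℝ ι) (j : κ) : stdSimplex.map φ x j = ∑ i with φ i = j, x i := by
  rw [stdSimplex.map_coe, FunOnFinite.linearMap_apply_apply]

/-- Coning is compatible with the maps of simplices that fix the cone vertex and preserve the
opposite face. -/
theorem coneFun_map (f : stdSimplex ℝ (Fin p) → ℤ) (φ : Fin (q + 1) → Fin (p + 1))
    (ψ : Fin q → Fin p) (h₀ : φ 0 = 0) (hs : ∀ i, φ i.succ = (ψ i).succ)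
    (x : stdSimplex ℝ (Fin (q + 1))) :
    coneFun f (stdSimplex.map φ x) = coneFun (f ∘ stdSimplex.map ψ) x := by
  have e₀ : stdSimplex.map φ x 0 = x 0 := by
    rw [stdSimplex_map_apply, Finset.sum_filter, Fin.sum_univ_succ]
    simp [h₀, hs]
  have es : ∀ j, stdSimplex.map φ x j.succ = ∑ i with ψ i = j, x i.succ := by
    intro j
    rw [stdSimplex_map_apply, Finset.sum_filter, Fin.sum_univ_succ, Finset.sum_filter]
    simp [h₀, hs, (Fin.succ_ne_zero j).symm]
  rw [coneFun, coneFun]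
  by_cases hx : x 0 < 1
  · rw [dif_pos hx, dif_pos (e₀ ▸ hx)]
    have : simplexTail (stdSimplex.map φ x) (e₀ ▸ hx) = stdSimplex.map ψ (simplexTail x hx) := by
      ext j
      refine Eq.trans ?_ (stdSimplex_map_apply ψ (simplexTail x hx) j).symm
      change stdSimplex.map φ x j.succ / (1 - stdSimplex.map φ x 0) =
        ∑ i with ψ i = j, x i.succ / (1 - x 0)
      rw [e₀, es, Finset.sum_div]
    rw [this, e₀]
    rfl
  · rw [dif_neg hx, dif_neg (e₀ ▸ hx)]

/-- The face opposite to the cone vertex is the original map. -/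
theorem coneFun_map_succ (f : stdSimplex ℝ (Fin p) → ℤ) (φ : Fin p → Fin (p + 1))
    (hφ : ∀ i, φ i = i.succ) (x : stdSimplex ℝ (Fin p)) :
    coneFun f (stdSimplex.map φ x) = f x := by
  have e₀ : stdSimplex.map φ x 0 = 0 := by
    rw [stdSimplex_map_apply, Finset.sum_filter]
    simp [hφ]
  have es : ∀ j, stdSimplex.map φ x j.succ = x j := by
    intro j
    rw [stdSimplex_map_apply, Finset.sum_filter]
    simp [hφ]
  have h₁ : stdSimplex.map φ x 0 < 1 := by rw [e₀]; exact one_pos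
  have ht : simplexTail (stdSimplex.map φ x) h₁ = x := by
    ext j
    change stdSimplex.map φ x j.succ / (1 - stdSimplex.map φ x 0) = x j
    rw [e₀, es, sub_zero, div_one]
  rw [coneFun, dif_pos h₁, ht, e₀, clampAt_zero]

theorem continuous_simplexTail :
    Continuous fun x : {x : stdSimplex ℝ (Fin (p + 1)) // x 0 < 1} => simplexTail x.1 x.2 := by
  refine Continuous.subtype_mk (continuous_pi fun i => ?_) _
  have hc : ∀ j, Continuous fun x : {x : stdSimplex ℝ (Fin (p + 1)) // x 0 < 1} => x.1 j :=
    fun j => (continuous_apply j).comp (continuous_subtype_val.comp continuous_subtype_val)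
  exact (hc _).div (continuous_const.sub (hc 0)) fun x => by have := x.2; linarith

theorem isContinuous_intClosure_iff {X : Type} [TopologicalSpace X] {m : ℕ} {f : X → ℤ} :
    IsContinuous (ofTopology X) (intClosure m) f ↔
      ∀ x, ∀ᶠ y in nhds x, |f y - f x| ≤ (m : ℤ) :=
  isContinuous_ofTopology_iff mem_intClosure_cl

theorem isContinuous_coneFun {m : ℕ} (hm : 1 ≤ m) {f : stdSimplex ℝ (Fin p) → ℤ}
    (hf : IsContinuous (ofTopology _) (intClosure m) f) :
    IsContinuous (ofTopology _) (intClosure m) (coneFun f) := by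
  rw [isContinuous_intClosure_iff] at hf ⊢
  intro x
  have hc : Continuous fun x : stdSimplex ℝ (Fin (p + 1)) => x 0 :=
    (continuous_apply 0).comp continuous_subtype_val
  by_cases hx : x 0 < 1
  · have hnear := (continuous_simplexTail.tendsto ⟨x, hx⟩).eventually (hf (simplexTail x hx))
    have hc' : Continuous fun x : {x : stdSimplex ℝ (Fin (p + 1)) // x 0 < 1} => x.1 0 :=
      hc.comp continuous_subtype_val
    rw [← map_nhds_subtype_coe_eq_nhds (p := fun x : stdSimplex ℝ (Fin (p + 1)) => x 0 < 1) hx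
        ((isOpen_lt hc continuous_const).mem_nhds hx),
      Filter.eventually_map]
    have hval : ∀ y : {x : stdSimplex ℝ (Fin (p + 1)) // x 0 < 1},
        coneFun f y.1 = clampAt (y.1 0) (f (simplexTail y.1 y.2)) := fun y => dif_pos y.2
    rw [show coneFun f x = _ from hval ⟨x, hx⟩]
    dsimp only at hnear ⊢
    simp only [hval]
    by_cases h0 : x 0 = 0
    · -- Near the face opposite to the cone vertex, the truncation is trivial on values close to
      -- the value at `x`.
      set B : ℤ := |f (simplexTail x hx)| + m + 1 with hB
      have hsmall : ∀ᶠ y : {x : stdSimplex ℝ (Fin (p + 1)) // x 0 < 1} in nhds ⟨x, hx⟩,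
          y.1 0 * (B : ℝ) < 1 :=
        ((hc'.mul continuous_const).tendsto _).eventually_lt_const (by simp [h0])
      filter_upwards [hnear, hsmall] with y hy hyB
      rw [h0, clampAt_zero, clampAt_eq_self (stdSimplex.zero_le y.1 0)]
      · exact hy
      · refine le_trans (mul_le_mul_of_nonneg_left ?_ (stdSimplex.zero_le y.1 0)) hyB.le
        have : |f (simplexTail y.1 y.2)| + 1 ≤ B := by
          have := abs_sub_abs_le_abs_sub (f (simplexTail y.1 y.2)) (f (simplexTail x hx))
          omega
        exact_mod_cast this
    · have hinv : ∀ᶠ y : {x : stdSimplex ℝ (Fin (p + 1)) // x 0 < 1} in nhds ⟨x, hx⟩,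
          |1 / y.1 0 - 1 / x 0| < 1 := by
        have hci : ContinuousAt (fun y : {x : stdSimplex ℝ (Fin (p + 1)) // x 0 < 1} =>
            |1 / y.1 0 - 1 / x 0|) ⟨x, hx⟩ :=
          ((continuousAt_const.div hc'.continuousAt h0).sub continuousAt_const).abs
        exact hci.eventually_lt_const (by simp)
      filter_upwards [hnear, hinv, hc'.continuousAt.eventually_ne h0] with y hy hyi hy0
      exact abs_clampAt_sub_le hm hy0 h0 hyi hy
  · have h1 : x 0 = 1 := le_antisymm (stdSimplex.le_one x 0) (not_lt.1 hx)
    have hhalf : (1 / 2 : ℝ) < x 0 := by rw [h1]; norm_num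
    filter_upwards [hc.continuousAt.eventually_const_lt hhalf] with y hy
    rw [coneFun_of_half_lt f hy, coneFun_of_half_lt f hhalf]
    simp

end Cone

open Simplicial Opposite

/-- The singular set of a closure space, augmented to a point. -/
noncomputable def CechClosure.augmentedSingularSet {X : Type} (c : CechClosure X) :
    SimplicialObject.Augmented Type :=
  c.singularSet.augmentOfIsTerminal Limits.Types.isTerminalPUnit

/-- Coning is an extra degeneracy on the singular set of `ℤ`. -/
noncomputable def intExtraDegeneracy {m : ℕ} (hm : 1 ≤ m) :
    (intClosure m).augmentedSingularSet.ExtraDegeneracy where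
  s' := TypeCat.ofHom fun _ => ⟨fun _ => 0, isContinuous_intClosure_iff.2 (by simp)⟩
  s n := TypeCat.ofHom fun σ => ⟨coneFun σ.1, isContinuous_coneFun hm σ.2⟩
  s'_comp_ε := Limits.Types.isTerminalPUnit.hom_ext _ _
  s₀_comp_δ₁ := by
    ext σ
    apply Subtype.ext
    funext x
    change coneFun σ.1 (stdSimplex.map (SimplexCategory.δ (1 : Fin 2)) x) = 0
    refine coneFun_of_half_lt _ ?_
    have : stdSimplex.map (SimplexCategory.δ (1 : Fin 2)) x 0 = 1 := by
      rw [stdSimplex_map_apply, Finset.sum_filter, Fin.sum_univ_one]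
      refine (if_pos rfl).trans ?_
      exact (Fin.sum_univ_one _).symm.trans (stdSimplex.sum_eq_one x)
    rw [this]
    norm_num
  s_comp_δ₀ n := by
    ext σ
    apply Subtype.ext
    funext x
    exact coneFun_map_succ σ.1 _ (fun i => rfl) x
  s_comp_δ n i := by
    ext σ
    apply Subtype.ext
    funext x
    exact coneFun_map σ.1 (i.succ.succAbove) (SimplexCategory.δ i) (Fin.succ_succAbove_zero i)
      (Fin.succ_succAbove_succ i) x
  s_comp_σ n i := by
    ext σ
    apply Subtype.ext
    funext x
    exact coneFun_map σ.1 (i.succ.predAbove) (SimplexCategory.σ i) Fin.predAbove_right_zero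
      (fun j => Fin.succ_predAbove_succ i j) x

/-! ### The chains of a free quotient by `ℤ` -/

section FreeQuotient

variable {E B : Type} {T : E → E} {π : E → B}

/-- If the orbits of `T` are infinite, then `T - 1` is injective on finitely supported functions: an
element of the kernel is constant along orbits. -/
theorem mapDomain_sub_injective (hT : ∀ x, Function.Injective fun k : ℕ => T^[k] x)
    (hTi : Function.Injective T) :
    Function.Injective
      (Finsupp.mapDomain.addMonoidHom (M := ℤ) T - AddMonoidHom.id (E →₀ ℤ)) := by
  rw [injective_iff_map_eq_zero]
  intro f hf
  have hf' : Finsupp.mapDomain T f = f := sub_eq_zero.1 hf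
  have hfT : ∀ x, f (T x) = f x := fun x => by
    conv_lhs => rw [← hf']
    exact Finsupp.mapDomain_apply hTi f x
  by_contra hne
  obtain ⟨x, hx⟩ := Finsupp.ne_iff.1 hne
  have hk : ∀ k : ℕ, f (T^[k] x) = f x := by
    intro k
    induction k with
    | zero => rfl
    | succ k ih => rw [Function.iterate_succ_apply', hfT, ih]
  refine Set.infinite_range_of_injective (hT x) (f.hasFiniteSupport.subset ?_)
  rintro _ ⟨k, rfl⟩
  exact (hk k).trans_ne hx

theorem single_iterate_sub_mem_range (x : E) (a : ℤ) (k : ℕ) :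
    Finsupp.single (T^[k] x) a - Finsupp.single x a ∈
      (Finsupp.mapDomain.addMonoidHom (M := ℤ) T - AddMonoidHom.id (E →₀ ℤ)).range := by
  induction k with
  | zero => simp
  | succ k ih =>
    rw [← sub_add_sub_cancel _ (Finsupp.single (T^[k] x) a)]
    refine add_mem ⟨Finsupp.single (T^[k] x) a, ?_⟩ ih
    simp [Function.iterate_succ_apply', Finsupp.mapDomain_single]

/-- If the fibres of `π` are the orbits of `T`, a chain that `π` kills lies in the range of
`T - 1`: modulo that range, every chain agrees with the chain obtained by replacing each element by
a representative of its fibre. -/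
theorem mem_range_of_mapDomain_eq_zero (hπ : Function.Surjective π)
    (horb : ∀ x y, π x = π y → ∃ k : ℕ, T^[k] x = y ∨ T^[k] y = x) {f : E →₀ ℤ}
    (hf : Finsupp.mapDomain π f = 0) :
    f ∈ (Finsupp.mapDomain.addMonoidHom (M := ℤ) T - AddMonoidHom.id (E →₀ ℤ)).range := by
  obtain ⟨s, hs⟩ := hπ.hasRightInverse
  have key : ∀ f : E →₀ ℤ, f - Finsupp.mapDomain (s ∘ π) f ∈
      (Finsupp.mapDomain.addMonoidHom (M := ℤ) T - AddMonoidHom.id (E →₀ ℤ)).range := by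
    intro f
    induction f using Finsupp.induction_linear with
    | zero => simp
    | add f g hf hg =>
      rw [Finsupp.mapDomain_add, add_sub_add_comm]
      exact add_mem hf hg
    | single x a =>
      rw [Finsupp.mapDomain_single]
      obtain ⟨k, hk | hk⟩ := horb ((s ∘ π) x) x (hs (π x))
      · have := single_iterate_sub_mem_range (T := T) ((s ∘ π) x) a k
        rwa [hk] at this
      · have := single_iterate_sub_mem_range (T := T) x a k
        rw [hk] at this
        exact sub_mem_comm_iff.1 this
  have := key f
  rwa [Finsupp.mapDomain_comp, hf, Finsupp.mapDomain_zero, sub_zero] at this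

/-- The sequence `ℤ[E] → ℤ[E] → ℤ[B]` given by `T - 1` and `π`. -/
noncomputable def finsuppShortComplex (hπT : π ∘ T = π) : ShortComplex AddCommGrpCat.{0} where
  X₁ := .of (E →₀ ℤ)
  X₂ := .of (E →₀ ℤ)
  X₃ := .of (B →₀ ℤ)
  f := AddCommGrpCat.ofHom (Finsupp.mapDomain.addMonoidHom T - AddMonoidHom.id _)
  g := AddCommGrpCat.ofHom (Finsupp.mapDomain.addMonoidHom π)
  zero := by
    ext1
    refine AddMonoidHom.ext fun f : E →₀ ℤ => ?_
    change Finsupp.mapDomain π (Finsupp.mapDomain T f - f) = 0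
    rw [Finsupp.mapDomain_sub, ← Finsupp.mapDomain_comp, hπT, sub_self]

theorem finsuppShortComplex_shortExact (hπT : π ∘ T = π)
    (hT : ∀ x, Function.Injective fun k : ℕ => T^[k] x) (hTi : Function.Injective T)
    (hπ : Function.Surjective π)
    (horb : ∀ x y, π x = π y → ∃ k : ℕ, T^[k] x = y ∨ T^[k] y = x) :
    (finsuppShortComplex hπT).ShortExact where
  exact := by
    rw [ShortComplex.ab_exact_iff]
    intro f hf
    exact mem_range_of_mapDomain_eq_zero hπ horb hf
  mono_f := (AddCommGrpCat.mono_iff_injective _).2 (mapDomain_sub_injective hT hTi)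
  epi_g := (AddCommGrpCat.epi_iff_surjective _).2 (Finsupp.mapDomain_surjective hπ)

end FreeQuotient

section Chains

open Limits

/-- The group of `n`-chains of a simplicial set is the group of finitely supported integer
functions on its `n`-simplices. -/
noncomputable def chainsIsoFinsupp (X : SSet.{0}) (n : ℕ) :
    (X.chainComplex (AddCommGrpCat.of ℤ)).X n ≅ AddCommGrpCat.of (X _⦋n⦌ →₀ ℤ) :=
  (X.isColimitChainComplexXCofan (AddCommGrpCat.of ℤ) n).coconePointUniqueUpToIso
    (t := Cofan.mk (AddCommGrpCat.of (X _⦋n⦌ →₀ ℤ))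
      fun x => AddCommGrpCat.ofHom (Finsupp.singleAddHom x))
    (Cofan.IsColimit.mk _
      (fun s => AddCommGrpCat.ofHom (Finsupp.liftAddHom fun x => (s.inj x).hom))
      (fun s x => by
        refine AddCommGrpCat.hom_ext ?_
        exact Finsupp.liftAddHom_comp_single (fun x => (s.inj x).hom) x)
      (fun s g hg => by
        ext : 1
        refine Finsupp.addHom_ext' fun x => ?_
        refine Eq.trans ?_ (Finsupp.liftAddHom_comp_single (fun x => (s.inj x).hom) x).symm
        rw [← hg x]
        rfl))

theorem ι_chainsIsoFinsupp_hom (X : SSet.{0}) {n : ℕ} (x : X _⦋n⦌) :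
    X.ιChainComplex x ≫ (chainsIsoFinsupp X n).hom =
      AddCommGrpCat.ofHom (Finsupp.singleAddHom x) :=
  (X.isColimitChainComplexXCofan (AddCommGrpCat.of ℤ) n).comp_coconePointUniqueUpToIso_hom
    _ ⟨x⟩

theorem chainComplexMap_chainsIsoFinsupp {X Y : SSet.{0}} (f : X ⟶ Y) (n : ℕ) :
    (SSet.chainComplexMap f (AddCommGrpCat.of ℤ)).f n ≫ (chainsIsoFinsupp Y n).hom =
      (chainsIsoFinsupp X n).hom ≫
        AddCommGrpCat.ofHom (Finsupp.mapDomain.addMonoidHom (f.app (op ⦋n⦌))) := by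
  refine SSet.chainComplex_hom_ext fun x => ?_
  rw [SSet.ι_chainComplexMap_f_assoc, ι_chainsIsoFinsupp_hom, ← Category.assoc,
    ι_chainsIsoFinsupp_hom]
  refine AddCommGrpCat.hom_ext (AddMonoidHom.ext fun a : ℤ => ?_)
  exact (Finsupp.mapDomain_single (f := f.app (op ⦋n⦌)) (a := x) (b := a)).symm

variable {E B : SSet.{0}}

/-- The sequence of chain complexes given by `T - 1` and `π`, for a simplicial set `E` over `B`
with an endomorphism `T`. -/
noncomputable def chainShortComplex (T : E ⟶ E) (π : E ⟶ B) (hπT : T ≫ π = π) :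
    ShortComplex (ChainComplex AddCommGrpCat.{0} ℕ) where
  X₁ := E.chainComplex (AddCommGrpCat.of ℤ)
  X₂ := E.chainComplex (AddCommGrpCat.of ℤ)
  X₃ := B.chainComplex (AddCommGrpCat.of ℤ)
  f := SSet.chainComplexMap T _ - 𝟙 _
  g := SSet.chainComplexMap π _
  zero := by
    rw [Preadditive.sub_comp, ← Functor.map_comp, hπT, Category.id_comp, sub_self]

theorem chainShortComplex_shortExact (T : E ⟶ E) (π : E ⟶ B) (hπT : T ≫ π = π)
    (hT : ∀ (n : ℕ) (x : E _⦋n⦌), Function.Injective fun k : ℕ => (T.app (op ⦋n⦌))^[k] x)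
    (hTi : ∀ n : ℕ, Function.Injective (T.app (op ⦋n⦌)))
    (hπ : ∀ n : ℕ, Function.Surjective (π.app (op ⦋n⦌)))
    (horb : ∀ (n : ℕ) (x y : E _⦋n⦌), π.app (op ⦋n⦌) x = π.app (op ⦋n⦌) y →
      ∃ k : ℕ, (T.app (op ⦋n⦌))^[k] x = y ∨ (T.app (op ⦋n⦌))^[k] y = x) :
    (chainShortComplex T π hπT).ShortExact := by
  refine HomologicalComplex.shortExact_of_degreewise_shortExact _ fun n => ?_
  have hn : (π.app (op ⦋n⦌) : E _⦋n⦌ → B _⦋n⦌) ∘ (T.app (op ⦋n⦌) : E _⦋n⦌ → E _⦋n⦌) =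
      π.app (op ⦋n⦌) := by
    funext x
    exact ConcreteCategory.congr_hom (NatTrans.congr_app hπT (op ⦋n⦌)) x
  refine ShortComplex.shortExact_of_iso
    (ShortComplex.isoMk (chainsIsoFinsupp E n) (chainsIsoFinsupp E n) (chainsIsoFinsupp B n)
      ?_ ?_).symm (finsuppShortComplex_shortExact hn (hT n) (hTi n) (hπ n) (horb n))
  · have h : ((SSet.chainComplexMap T (AddCommGrpCat.of ℤ)).f n - 𝟙 _) ≫
          (chainsIsoFinsupp E n).hom =
        (chainsIsoFinsupp E n).hom ≫ (AddCommGrpCat.ofHom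
          (Finsupp.mapDomain.addMonoidHom (T.app (op ⦋n⦌))) - 𝟙 _) := by
      rw [Preadditive.sub_comp, chainComplexMap_chainsIsoFinsupp, Category.id_comp,
        Preadditive.comp_sub, Category.comp_id]
    exact h.symm
  · exact (chainComplexMap_chainsIsoFinsupp π n).symm

/-- An equivariant map of free `ℤ`-covers that is a quasi-isomorphism induces a quasi-isomorphism
of the bases. -/
theorem quasiIso_chainComplexMap_of_cover {E' B' : SSet.{0}} {T : E ⟶ E} {π : E ⟶ B}
    {T' : E' ⟶ E'} {π' : E' ⟶ B'} (hπT : T ≫ π = π) (hπT' : T' ≫ π' = π')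
    (hS : (chainShortComplex T π hπT).ShortExact)
    (hS' : (chainShortComplex T' π' hπT').ShortExact)
    (F : E ⟶ E') (f : B ⟶ B') (hT : T ≫ F = F ≫ T') (hπ : π ≫ f = F ≫ π')
    (hF : QuasiIso (SSet.chainComplexMap F (AddCommGrpCat.of ℤ))) :
    QuasiIso (SSet.chainComplexMap f (AddCommGrpCat.of ℤ)) := by
  have h₁ : SSet.chainComplexMap F (AddCommGrpCat.of ℤ) ≫ (SSet.chainComplexMap T' _ - 𝟙 _) =
      (SSet.chainComplexMap T _ - 𝟙 _) ≫ SSet.chainComplexMap F _ := by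
    rw [Preadditive.comp_sub, Preadditive.sub_comp, ← Functor.map_comp, ← Functor.map_comp,
      hT, Category.id_comp, Category.comp_id]
  have h₂ : SSet.chainComplexMap F (AddCommGrpCat.of ℤ) ≫ SSet.chainComplexMap π' _ =
      SSet.chainComplexMap π _ ≫ SSet.chainComplexMap f _ := by
    rw [← Functor.map_comp, ← Functor.map_comp, hπ]
  let φ : chainShortComplex T π hπT ⟶ chainShortComplex T' π' hπT' :=
    { τ₁ := SSet.chainComplexMap F _
      τ₂ := SSet.chainComplexMap F _
      τ₃ := SSet.chainComplexMap f _
      comm₁₂ := h₁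
      comm₂₃ := h₂ }
  exact HomologicalComplex.HomologySequence.quasiIso_τ₃ φ hS hS' hF hF

end Chains

/-! ### Maps of singular sets -/

/-- The map of singular sets induced by a continuous map of closure spaces. -/
noncomputable def CechClosure.singularSetMap {X Y : Type} {c : CechClosure X} {d : CechClosure Y}
    (f : X → Y) (hf : IsContinuous c d f) : c.singularSet ⟶ d.singularSet where
  app _ := TypeCat.ofHom fun σ => ⟨f ∘ σ.1, hf.comp σ.2⟩

open AlgebraicTopology SimplicialObject in
/-- A continuous map between two integer lines is a quasi-isomorphism on singular chains, because
both are homotopy equivalent to a point. -/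
theorem quasiIso_singularSetMap_int {m m' : ℕ} (hm : 1 ≤ m) (hm' : 1 ≤ m') (f : ℤ → ℤ)
    (hf : IsContinuous (intClosure m) (intClosure m') f) :
    QuasiIso (SSet.chainComplexMap (singularSetMap f hf) (AddCommGrpCat.of ℤ)) := by
  let R := AddCommGrpCat.of ℤ
  let W := (Augmented.whiskering Type AddCommGrpCat.{0}).obj (Limits.sigmaConst.obj R)
  let F : (intClosure m).augmentedSingularSet ⟶ (intClosure m').augmentedSingularSet :=
    { left := singularSetMap f hf
      right := 𝟙 _ }
  -- The augmentations of both complexes are quasi-isomorphisms, and `f` is compatible with them.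
  have h1 := ((intExtraDegeneracy hm).map (Limits.sigmaConst.obj R)).homotopyEquiv.quasiIso_hom
  have h2 := ((intExtraDegeneracy hm').map (Limits.sigmaConst.obj R)).homotopyEquiv.quasiIso_hom
  have h3 := AlternatingFaceMapComplex.ε.naturality (W.map F)
  have h4 : QuasiIso (SSet.chainComplexMap (singularSetMap f hf) (AddCommGrpCat.of ℤ) ≫
      AlternatingFaceMapComplex.ε.app (W.obj (intClosure m').augmentedSingularSet)) := by
    have h5 : SSet.chainComplexMap (singularSetMap f hf) (AddCommGrpCat.of ℤ) ≫
      AlternatingFaceMapComplex.ε.app (W.obj (intClosure m').augmentedSingularSet) =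
        AlternatingFaceMapComplex.ε.app (W.obj (intClosure m).augmentedSingularSet) := by
      have h6 : (Augmented.point ⋙ ChainComplex.single₀ AddCommGrpCat.{0}).map (W.map F) = 𝟙 _ :=
        (congrArg (ChainComplex.single₀ _).map ((Limits.sigmaConst.obj R).map_id _)).trans
          (CategoryTheory.Functor.map_id _ _)
      refine h3.trans ?_
      rw [h6]
      exact Category.comp_id _
    rw [h5]
    exact h1
  exact quasiIso_of_comp_right (hφ := h2) (hφφ' := h4)

/-! ### The covering of `ℤ_n` by `ℤ` -/

section Shift

variable {m : ℕ}

theorem isContinuous_add_const (k : ℤ) :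
    IsContinuous (intClosure m) (intClosure m) (fun a => a + k) :=
  isContinuous_of_rel mem_intClosure_cl mem_intClosure_cl fun a b hab => by simpa using hab

/-- Translation by `n` on the singular set of `ℤ`. -/
noncomputable def singularShift (n m : ℕ) :
    (intClosure m).singularSet ⟶ (intClosure m).singularSet :=
  singularSetMap _ (isContinuous_add_const (n : ℤ))

theorem singularShift_iterate {n p : ℕ} (k : ℕ) (σ : (intClosure m).singularSet _⦋p⦌)
    (x : stdSimplex ℝ (Fin (p + 1))) :
    ((((singularShift n m).app (op ⦋p⦌))^[k] σ : SingularSimplex (intClosure m) p)).1 x =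
      (show SingularSimplex (intClosure m) p from σ).1 x + n * k := by
  induction k with
  | zero => simp
  | succ k ih =>
    rw [Function.iterate_succ_apply']
    refine Eq.trans (congrArg (· + (n : ℤ)) ih) ?_
    push_cast
    ring

end Shift

/-- The residue of an integer modulo `n`. -/
def intToCyclic (n : ℕ) [NeZero n] (a : ℤ) : Fin n :=
  ⟨(a % n).toNat, by
    have hn : (0 : ℤ) < n := by exact_mod_cast Nat.pos_of_neZero n
    have := Int.emod_lt_of_pos a hn
    have := Int.emod_nonneg a hn.ne'
    omega⟩

section Covering

variable {n m : ℕ} [NeZero n]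

theorem intToCyclic_val (a : ℤ) : ((intToCyclic n a : ℕ) : ℤ) = a % n :=
  Int.toNat_of_nonneg (Int.emod_nonneg a (by exact_mod_cast NeZero.ne n))

theorem intToCyclic_eq_iff {a b : ℤ} :
    intToCyclic n a = intToCyclic n b ↔ (n : ℤ) ∣ a - b := by
  rw [← Int.emod_eq_emod_iff_emod_sub_eq_zero.trans Int.dvd_iff_emod_eq_zero.symm, Fin.ext_iff,
    ← Nat.cast_inj (R := ℤ), intToCyclic_val, intToCyclic_val]

theorem intToCyclic_val_self (i : Fin n) : intToCyclic n (i : ℕ) = i := by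
  rw [Fin.ext_iff, ← Nat.cast_inj (R := ℤ), intToCyclic_val]
  exact Int.emod_eq_of_lt (by positivity) (by exact_mod_cast i.2)

theorem dvd_intToCyclic_sub (a : ℤ) : (n : ℤ) ∣ ((intToCyclic n a : ℕ) : ℤ) - a := by
  rw [intToCyclic_val, Int.emod_def]
  exact ⟨-(a / n), by ring⟩

theorem isContinuous_intToCyclic :
    IsContinuous (intClosure m) (cyclicClosure n m) (intToCyclic n) := by
  refine isContinuous_of_rel mem_intClosure_cl mem_cyclicClosure_cl fun a b hab =>
    ⟨a - b, hab, ?_⟩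
  have := dvd_sub (dvd_intToCyclic_sub (n := n) a) (dvd_intToCyclic_sub (n := n) b)
  rwa [sub_sub_sub_comm] at this

variable (n m) in
/-- The projection of singular sets from `ℤ` to `ℤ_n`. -/
noncomputable def singularProj : (intClosure m).singularSet ⟶ (cyclicClosure n m).singularSet :=
  singularSetMap _ isContinuous_intToCyclic

theorem singularShift_comp_singularProj :
    singularShift n m ≫ singularProj n m = singularProj n m := by
  ext p σ
  apply Subtype.ext
  funext x
  have h : (n : ℤ) ∣ (show SingularSimplex (intClosure m) p.unop.len from σ).1 x + n -
      (show SingularSimplex (intClosure m) p.unop.len from σ).1 x := by simp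
  exact intToCyclic_eq_iff.2 h

/-- Every singular simplex of `ℤ_n` lifts to `ℤ`. -/
theorem singularProj_surjective (hmn : 3 * m < n) (p : ℕ) :
    Function.Surjective ((singularProj n m).app (op ⦋p⦌)) := by
  intro (σ : SingularSimplex (cyclicClosure n m) p)
  have hσ := (isContinuous_ofTopology_iff mem_cyclicClosure_cl).1 σ.2
  obtain ⟨h, hh⟩ := exists_isLiftOn_stdSimplex (g := fun x => ((σ.1 x : ℕ) : ℤ)) hmn hσ
  refine ⟨(⟨h, isContinuous_intClosure_iff.2 fun x => ?_⟩ : SingularSimplex (intClosure m) p), ?_⟩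
  · simpa using hh.2 x (Set.mem_univ x)
  · apply Subtype.ext
    funext x
    exact (intToCyclic_eq_iff.2 (hh.1 x (Set.mem_univ x))).trans (intToCyclic_val_self _)

/-- Two lifts of the same singular simplex differ by a translation. -/
theorem singularProj_eq (hmn : 2 * m < n) (p : ℕ) (σ τ : (intClosure m).singularSet _⦋p⦌)
    (h : (singularProj n m).app (op ⦋p⦌) σ = (singularProj n m).app (op ⦋p⦌) τ) :
    ∃ k : ℕ, ((singularShift n m).app (op ⦋p⦌))^[k] σ = τ ∨
      ((singularShift n m).app (op ⦋p⦌))^[k] τ = σ := by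
  have lift : ∀ ρ : SingularSimplex (intClosure m) p,
      ∀ x ∈ Set.univ, ∀ᶠ y in nhdsWithin x Set.univ, |ρ.1 y - ρ.1 x| ≤ (m : ℤ) := fun ρ x _ => by
    simpa using isContinuous_intClosure_iff.1 ρ.2 x
  have hpt : ∀ x, (n : ℤ) ∣ (show SingularSimplex (intClosure m) p from τ).1 x -
      (show SingularSimplex (intClosure m) p from σ).1 x := fun x =>
    intToCyclic_eq_iff.1 (congrFun (congrArg Subtype.val h) x).symm
  obtain ⟨_, ⟨c, rfl⟩, hc⟩ := IsLiftOn.exists_eq_add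
    (g := (show SingularSimplex (intClosure m) p from σ).1) hmn isPreconnected_univ
    ⟨fun x _ => by simp, lift σ⟩ ⟨fun x _ => hpt x, lift τ⟩
  rcases Int.eq_nat_or_neg c with ⟨k, rfl | rfl⟩
  · refine ⟨k, Or.inl (Subtype.ext (funext fun x => ?_))⟩
    rw [singularShift_iterate, hc x (Set.mem_univ x)]
  · refine ⟨k, Or.inr (Subtype.ext (funext fun x => ?_))⟩
    rw [singularShift_iterate, hc x (Set.mem_univ x)]
    ring

/-- The singular chains of `ℤ_n` are the quotient of the singular chains of `ℤ` by the free action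
of translation by `n`. -/
theorem singular_shortExact (hmn : 3 * m < n) :
    (chainShortComplex (singularShift n m) (singularProj n m)
      singularShift_comp_singularProj).ShortExact := by
  have hn : (n : ℤ) ≠ 0 := by exact_mod_cast NeZero.ne n
  refine chainShortComplex_shortExact _ _ _ (fun p σ k l hkl => ?_) (fun p σ τ h => ?_)
    (singularProj_surjective hmn) (singularProj_eq (by omega))
  · obtain ⟨x⟩ : Nonempty (stdSimplex ℝ (Fin (p + 1))) := inferInstance
    have h := congrFun (congrArg Subtype.val hkl) x
    rw [singularShift_iterate, singularShift_iterate] at h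
    have h' := mul_left_cancel₀ hn (add_left_cancel h)
    exact_mod_cast h'
  · refine Subtype.ext (funext fun x => ?_)
    exact add_right_cancel (congrFun (congrArg Subtype.val h) x)

end Covering

/-! ### Comparison of two cycles -/

section Rescale

variable {n n' m m' : ℕ} [NeZero n]

/-- The map `a ↦ ⌊n' a / n⌋`, which carries translation by `n` to translation by `n'`. -/
def intRescale (n n' : ℕ) (a : ℤ) : ℤ := n' * a / n

theorem intRescale_add_mul (a k : ℤ) :
    intRescale n n' (a + n * k) = intRescale n n' a + n' * k := by
  have hn : (n : ℤ) ≠ 0 := by exact_mod_cast NeZero.ne n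
  rw [intRescale, show (n' : ℤ) * (a + n * k) = n' * a + n' * k * n by ring,
    Int.add_mul_ediv_right _ _ hn]
  rfl

theorem abs_intRescale_sub_le (h : m * n' ≤ m' * n) {a b : ℤ} (hab : |a - b| ≤ (m : ℤ)) :
    |intRescale n n' a - intRescale n n' b| ≤ (m' : ℤ) := by
  have hn : (0 : ℤ) < n := by exact_mod_cast Nat.pos_of_neZero n
  have key : ∀ a b : ℤ, a - b ≤ m → intRescale n n' a ≤ intRescale n n' b + m' := by
    intro a b hab
    rw [intRescale, intRescale, ← Int.add_mul_ediv_right _ _ hn.ne']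
    refine Int.ediv_le_ediv hn ?_
    have h1 : (n' : ℤ) * (a - b) ≤ n' * m := mul_le_mul_of_nonneg_left hab (by positivity)
    have h2 : (m : ℤ) * n' ≤ m' * n := by exact_mod_cast h
    linarith
  rw [abs_le] at *
  have := key a b (by omega)
  have := key b a (by omega)
  omega

theorem isContinuous_intRescale (h : m * n' ≤ m' * n) :
    IsContinuous (intClosure m) (intClosure m') (intRescale n n') :=
  isContinuous_of_rel mem_intClosure_cl mem_intClosure_cl fun _ _ => abs_intRescale_sub_le h

variable [NeZero n']

theorem intToCyclic_intRescale_eq {a b : ℤ} (h : (n : ℤ) ∣ a - b) :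
    intToCyclic n' (intRescale n n' a) = intToCyclic n' (intRescale n n' b) := by
  obtain ⟨k, hk⟩ := h
  rw [show a = b + n * k by omega, intRescale_add_mul, intToCyclic_eq_iff]
  simp

theorem isContinuous_cyclicRescale (h : m * n' ≤ m' * n) :
    IsContinuous (cyclicClosure n m) (cyclicClosure n' m')
      (fun i => intToCyclic n' (intRescale n n' (i : ℕ))) := by
  refine isContinuous_of_rel mem_cyclicClosure_cl mem_cyclicClosure_cl ?_
  rintro i j ⟨d, hd, hdvd⟩
  refine ⟨intRescale n n' ((j : ℕ) + d) - intRescale n n' (j : ℕ),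
    abs_intRescale_sub_le h (by simpa using hd), ?_⟩
  rw [intToCyclic_intRescale_eq (b := (j : ℕ) + d) (by rwa [← sub_sub])]
  have := dvd_sub (dvd_intToCyclic_sub (n := n') (intRescale n n' ((j : ℕ) + d)))
    (dvd_intToCyclic_sub (n := n') (intRescale n n' (j : ℕ)))
  rwa [sub_sub_sub_comm] at this

/-- Rescaling `ℤ_n` to `ℤ_{n'}` is a quasi-isomorphism, as it is covered by an equivariant map of
integer lines. -/
theorem quasiIso_cyclicRescale (hm : 1 ≤ m) (hm' : 1 ≤ m') (hmn : 3 * m < n) (hmn' : 3 * m' < n')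
    (h : m * n' ≤ m' * n) :
    QuasiIso (SSet.chainComplexMap (singularSetMap _ (isContinuous_cyclicRescale h))
      (AddCommGrpCat.of ℤ)) := by
  refine quasiIso_chainComplexMap_of_cover singularShift_comp_singularProj
    singularShift_comp_singularProj (singular_shortExact hmn) (singular_shortExact hmn')
    (singularSetMap _ (isContinuous_intRescale h)) _ ?_ ?_
    (quasiIso_singularSetMap_int hm hm' _ _)
  · ext p σ
    apply Subtype.ext
    funext x
    have := intRescale_add_mul (n := n) (n' := n')
      ((show SingularSimplex (intClosure m) p.unop.len from σ).1 x) 1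
    rwa [mul_one, mul_one] at this
  · ext p σ
    apply Subtype.ext
    funext x
    exact intToCyclic_intRescale_eq (dvd_intToCyclic_sub _)

end Rescale

theorem mainTheorem10 (m l n : ℕ) (hm : 2 ≤ m) (hn : n = 3 * m + l)
    (hl : max 0 ((m : ℤ) - 3) < (l : ℤ)) (hlm : l < m) (k : ℕ) :
    Nonempty ((cyclicClosure n m).singularHomology k ≅
      (cyclicClosure (n + 4) (m + 1)).singularHomology k) := by
  have hl' : 0 < l := by
    have := (le_max_left 0 ((m : ℤ) - 3)).trans_lt hl
    exact_mod_cast this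
  have : NeZero n := ⟨by omega⟩
  -- This says that `n ≤ 4 * m`.
  have h : (m + 1) * n ≤ m * (n + 4) := by nlinarith
  have hq := quasiIso_cyclicRescale (by omega) (by omega) (by omega) (by omega) h
  have hi := (quasiIsoAt_iff_isIso_homologyMap _ k).1 (hq.quasiIsoAt k)
  exact ⟨(asIso (HomologicalComplex.homologyMap (SSet.chainComplexMap (singularSetMap _
    (isContinuous_cyclicRescale h)) (AddCommGrpCat.of ℤ)) k)).symm⟩
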